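/- Let $\omega=\{0,1,2,\dots\}$ and let $$\mathcal D=\Big\{A\subseteq\omega:\ \lim_{n\to\infty}\frac{|A\cap\{0,\dots,n-1\}|}{n}\ \text{exists and belongs to}\ \{0,1\}\Big\},$$ which is a Boolean subalgebra of the power set of $\omega$. Let $St(\mathcal D)$ be its Stone space, i.e. the space of all ultrafilters $u$ on the Boolean algebra $\mathcal D$ with the topology generated by the sets $[A]=\{u: A\in u\}$, $A\in\mathcal D$. A signed Borel measure $\mu$ on a Tychonoff space $X$ is finitely supported if it is a finite linear combination $\mu=\sum_{x\in F}\alpha_x\delta_x$ of point measures with $F\subseteq X$ finite and all $\alpha_x\neq0$; then $\mathrm{supp}(\mu)=F$, and its norm (total variation) is $\|\mu\|=\sum_{x\in F}|\alpha_x|$. A JN-sequence (finitely supported Josefson–Nissenzweig sequence) on $X$ is a sequence $(\mu_n)_{n\in\omega}$ of finitely supported signed Borel measures on $X$ such that $\|\mu_n\|=1$ for every $n$ and $\int_X f\,d\mu_n\to0$ for every continuous function $f\colon X\to\mathbb R$. Then: 1. there exists a JN-sequence on $St(\mathcal D)$; 2. every JN-sequence $(\mu_n)_{n\in\omega}$ on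 $St(\mathcal D)$ satisfies $\lim_{n\to\infty}|\mathrm{supp}(\mu_n)|=\infty$. -/

import Mathlib

open Filter Topology MeasureTheory

noncomputable section

/-! ### Stone spaces of Boolean algebras -/

/-- The Stone space `St(α)` of a Boolean algebra `α`: the set of all ultrafilters on `α`. -/
@[ext]
structure StoneSpace (α : Type*) [BooleanAlgebra α] where
  /-- the elements of the ultrafilter -/
  carrier : Set α
  top_mem : ⊤ ∈ carrier
  bot_notMem : ⊥ ∉ carrier
  mem_of_le : ∀ {a b : α}, a ∈ carrier → a ≤ b → b ∈ carrier
  inf_mem : ∀ {a b : α}, a ∈ carrier → b ∈ carrier → a ⊓ b ∈ carrier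
  mem_or_compl_mem : ∀ a : α, a ∈ carrier ∨ aᶜ ∈ carrier

namespace StoneSpace

variable {α : Type*} [BooleanAlgebra α]

/-- The set `[a] = {u : a ∈ u}` of the Stone space given by an element `a` of the algebra. -/
def basicClopen (a : α) : Set (StoneSpace α) := {u | a ∈ u.carrier}

/-- The Stone topology, generated by the sets `[a]`. -/
instance : TopologicalSpace (StoneSpace α) :=
  TopologicalSpace.generateFrom (Set.range basicClopen)

/-- Stone spaces carry their Borel σ-algebra. -/
instance : MeasurableSpace (StoneSpace α) := borel _

instance : BorelSpace (StoneSpace α) := ⟨rfl⟩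

theorem compl_mem_iff (u : StoneSpace α) (a : α) : aᶜ ∈ u.carrier ↔ a ∉ u.carrier := by
  refine ⟨fun h h' => u.bot_notMem ?_, fun h => (u.mem_or_compl_mem a).resolve_left h⟩
  simpa using u.inf_mem h' h

theorem isOpen_basicClopen (a : α) : IsOpen (basicClopen a) :=
  TopologicalSpace.isOpen_generateFrom_of_mem ⟨a, rfl⟩

instance : T2Space (StoneSpace α) := by
  refine ⟨fun u v huv => ?_⟩
  have key : ∃ a, a ∈ u.carrier ∧ a ∉ v.carrier := by
    by_contra! h
    refine huv (StoneSpace.ext (Set.Subset.antisymm h fun a ha => ?_))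
    by_contra hau
    exact (v.compl_mem_iff a).1 (h _ ((u.compl_mem_iff a).2 hau)) ha
  obtain ⟨a, hau, hav⟩ := key
  refine ⟨basicClopen a, basicClopen aᶜ, isOpen_basicClopen a, isOpen_basicClopen aᶜ, hau,
    (v.compl_mem_iff a).2 hav, Set.disjoint_left.2 fun w hw hw' => ?_⟩
  exact (w.compl_mem_iff a).1 hw' hw

instance : CompactSpace (StoneSpace α) := by
  refine ⟨isCompact_iff_ultrafilter_le_nhds.2 fun f _ => ?_⟩
  let u : StoneSpace α :=
    { carrier := {a | basicClopen a ∈ f}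
      top_mem := by
        have : basicClopen (⊤ : α) = Set.univ := Set.eq_univ_of_forall fun w => w.top_mem
        rw [Set.mem_ofPred_eq, this]
        exact univ_mem
      bot_notMem := by
        have : basicClopen (⊥ : α) = ∅ := Set.eq_empty_of_forall_notMem fun w => w.bot_notMem
        simp [this]
      mem_of_le := fun ha hab => mem_of_superset ha fun w hw => w.mem_of_le hw hab
      inf_mem := fun ha hb => mem_of_superset (inter_mem ha hb) fun w hw => w.inf_mem hw.1 hw.2
      mem_or_compl_mem := fun a => by
        refine (Ultrafilter.mem_or_compl_mem f (basicClopen a)).imp id fun h => ?_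
        exact mem_of_superset h fun w hw => (w.compl_mem_iff a).2 hw }
  refine ⟨u, Set.mem_univ _, ?_⟩
  rw [TopologicalSpace.nhds_generateFrom]
  refine le_iInf₂ fun s hs => ?_
  obtain ⟨hus, a, rfl⟩ := hs
  exact le_principal_iff.2 hus

end StoneSpace

/-! ### Finitely supported signed measures and JN-sequences -/

section JN

variable {X : Type*} [TopologicalSpace X] [MeasurableSpace X]

/-- A signed measure is finitely supported if it is a finite linear combination of point measures
(`VectorMeasure.dirac x c` is the measure `c • δ_x`). -/
def IsFinitelySupported (μ : SignedMeasure X) : Prop :=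
  ∃ c : X →₀ ℝ, μ = ∑ x ∈ c.support, VectorMeasure.dirac x (c x)

/-- The support of a finitely supported signed measure: the set of points of non-zero mass. -/
def finSupp (μ : SignedMeasure X) : Set X := {x | μ {x} ≠ 0}

open scoped VectorMeasure in
/-- A (finitely supported) Josefson–Nissenzweig sequence on a Tychonoff space `X`: a sequence of
finitely supported signed Borel measures of norm (total variation) one such that the integrals of
every continuous real-valued function converge to `0`. -/
structure IsJNSequence [T35Space X] [BorelSpace X] (μ : ℕ → SignedMeasure X) : Prop where
  finitelySupported : ∀ n, IsFinitelySupported (μ n)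
  norm_eq_one : ∀ n, (μ n).variation Set.univ = 1
  tendsto_integral : ∀ f : C(X, ℝ), Tendsto (fun n => ∫ᵛ x, f x ∂•(μ n)) atTop (𝓝 0)

end JN

/-! ### The algebra of sets of asymptotic density zero or one -/

/-- `A ⊆ ℕ` has asymptotic density `d`: `|A ∩ {0, …, n - 1}| / n → d`. -/
def HasAsympDensity (A : Set ℕ) (d : ℝ) : Prop :=
  Tendsto (fun n : ℕ => ((A ∩ Set.Iio n).ncard : ℝ) / (n : ℝ)) atTop (𝓝 d)

namespace HasAsympDensity

theorem empty : HasAsympDensity ∅ 0 := by simp [HasAsympDensity]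

theorem compl {A : Set ℕ} {d : ℝ} (h : HasAsympDensity A d) : HasAsympDensity Aᶜ (1 - d) := by
  refine (Tendsto.const_sub 1 h).congr' ?_
  filter_upwards [eventually_gt_atTop 0] with n hn
  have h1 : (A ∩ Set.Iio n).ncard + (Aᶜ ∩ Set.Iio n).ncard = n := by
    rw [← Set.ncard_union_eq (disjoint_compl_right.mono Set.inter_subset_left Set.inter_subset_left)
      ((Set.finite_Iio n).inter_of_right _) ((Set.finite_Iio n).inter_of_right _),
      ← Set.union_inter_distrib_right, Set.union_compl_self, Set.univ_inter]
    simp [Set.ncard_eq_toFinset_card']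
  have h2 : ((A ∩ Set.Iio n).ncard : ℝ) + ((Aᶜ ∩ Set.Iio n).ncard : ℝ) = n := by exact_mod_cast h1
  have hn' : (n : ℝ) ≠ 0 := by positivity
  field_simp
  linarith

theorem union_zero {A B : Set ℕ} (hA : HasAsympDensity A 0) (hB : HasAsympDensity B 0) :
    HasAsympDensity (A ∪ B) 0 := by
  have h := Tendsto.add hA hB
  rw [add_zero] at h
  refine squeeze_zero (fun n => by positivity) (fun n => ?_) h
  rw [← add_div, Set.union_inter_distrib_right]
  gcongr
  exact_mod_cast Set.ncard_union_le _ _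

theorem mono_one {A B : Set ℕ} (hA : HasAsympDensity A 1) (hAB : A ⊆ B) :
    HasAsympDensity B 1 := by
  refine tendsto_of_tendsto_of_tendsto_of_le_of_le hA tendsto_const_nhds (fun n => ?_) fun n => ?_
  · have : (A ∩ Set.Iio n).ncard ≤ (B ∩ Set.Iio n).ncard :=
      Set.ncard_le_ncard (Set.inter_subset_inter_left _ hAB) ((Set.finite_Iio n).inter_of_right _)
    dsimp only
    gcongr
  · have : (B ∩ Set.Iio n).ncard ≤ n := by
      calc (B ∩ Set.Iio n).ncard ≤ (Set.Iio n).ncard :=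
            Set.ncard_le_ncard Set.inter_subset_right (Set.finite_Iio n)
        _ = n := by simp [Set.ncard_eq_toFinset_card']
    exact div_le_one_of_le₀ (Nat.cast_le.2 this) (by positivity)

end HasAsympDensity

theorem density_compl_mem {A : Set ℕ} (h : HasAsympDensity A 0 ∨ HasAsympDensity A 1) :
    HasAsympDensity Aᶜ 0 ∨ HasAsympDensity Aᶜ 1 := by
  rcases h with h | h
  · exact Or.inr (by simpa using h.compl)
  · exact Or.inl (by simpa using h.compl)

theorem density_union_mem {A B : Set ℕ} (hA : HasAsympDensity A 0 ∨ HasAsympDensity A 1)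
    (hB : HasAsympDensity B 0 ∨ HasAsympDensity B 1) :
    HasAsympDensity (A ∪ B) 0 ∨ HasAsympDensity (A ∪ B) 1 := by
  rcases hA with hA | hA
  · rcases hB with hB | hB
    · exact Or.inl (hA.union_zero hB)
    · exact Or.inr (hB.mono_one Set.subset_union_right)
  · exact Or.inr (hA.mono_one Set.subset_union_left)

/-- Plebanek's algebra `𝒟`: the subsets of `ℕ` of asymptotic density `0` or `1`, as a Boolean
subalgebra of the power set of `ℕ`. -/
def plebanekAlgebra : BooleanSubalgebra (Set ℕ) where
  carrier := {A | HasAsympDensity A 0 ∨ HasAsympDensity A 1}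
  supClosed' := fun _ hA _ hB => density_union_mem hA hB
  infClosed' := fun A hA B hB => by
    have h := density_compl_mem (density_union_mem (density_compl_mem hA) (density_compl_mem hB))
    rwa [Set.compl_union, compl_compl, compl_compl] at h
  compl_mem' := fun hA => density_compl_mem hA
  bot_mem' := Or.inl HasAsympDensity.empty

end

/-! Existence. The ultrafilter p of density-one sets is the Cesàro limit of the principal
ultrafilters: for each η > 0 a continuous function is within η of its value at p on a density-one
set of integers. Half the difference between the averages of principal ultrafilters and p is
therefore a JN-sequence.

Growth of supports. Suppose that the supports have bounded size along a subsequence. Passing to a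
pointwise convergent subsequence and subtracting later terms gives measures that are null on every
clopen set and at every point, with norms bounded below (`exists_pointwise_null`). A gliding hump
(`exists_gliding_hump`) puts almost all of their mass on pairwise disjoint finite sets of bounded
size. The heart is `exists_disjoint_neighbourhoods`: a subsequence of these sets has disjoint clopen
neighbourhoods [a_i] such that the union of the a_i ⊆ ω has density zero. Every subset of that union
lies in 𝒟, so a single B ∈ 𝒟 can select, in each hump, points of one sign carrying half of the mass.
The masses of B then stay away from zero, a contradiction (`not_pointwise_null`).

The size bound M enters by pigeonhole: among M + 1 disjoint clopen sets, one misses a given set of M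
points. -/

noncomputable section

/-! ### Finitely supported measures as finitely supported functions -/

section PointMeasure

variable {X : Type*} [MeasurableSpace X]

/-- The signed measure `∑ c x • δ_x` attached to a finitely supported function. -/
def pointMeasure (c : X →₀ ℝ) : SignedMeasure X := ∑ x ∈ c.support, VectorMeasure.dirac x (c x)

theorem pointMeasure_apply (c : X →₀ ℝ) {s : Set X} (hs : MeasurableSet s) [DecidablePred (· ∈ s)] :
    pointMeasure c s = ∑ x ∈ c.support, if x ∈ s then c x else 0 := by
  rw [pointMeasure, FunLike.coe_sum, Finset.sum_apply]
  refine Finset.sum_congr rfl fun x _ => ?_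
  split_ifs with h
  · exact VectorMeasure.dirac_apply_of_mem hs h
  · exact VectorMeasure.dirac_apply_of_notMem h

variable [MeasurableSingletonClass X]

theorem pointMeasure_singleton (c : X →₀ ℝ) (x : X) : pointMeasure c {x} = c x := by
  classical
  rw [pointMeasure_apply c (measurableSet_singleton x)]
  simp +contextual [eq_comm]

theorem variation_pointMeasure (c : X →₀ ℝ) :
    (pointMeasure c).variation Set.univ = ENNReal.ofReal (∑ x ∈ c.support, |c x|) := by
  classical
  have hsum : ENNReal.ofReal (∑ x ∈ c.support, |c x|) = ∑ x ∈ c.support, ‖c x‖ₑ := by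
    rw [ENNReal.ofReal_sum_of_nonneg fun _ _ => abs_nonneg _]
    exact Finset.sum_congr rfl fun x _ => by rw [← Real.norm_eq_abs, ofReal_norm]
  rw [hsum]
  apply le_antisymm
  · refine (VectorMeasure.variation_finsetSum_le c.support
      (fun x => VectorMeasure.dirac x (c x)) Set.univ).trans (le_of_eq ?_)
    simp [Measure.finsetSum_apply]
  -- The singletons of the support are disjoint sets that already exhaust the variation.
  · have h := VectorMeasure.le_variation (pointMeasure c) (s := Set.univ) MeasurableSet.univ
      (P := c.support.image fun x => ({x} : Set X)) (by simp) (by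
        intro a ha b hb hab
        simp only [Finset.coe_image, Set.mem_image] at ha hb
        obtain ⟨x, -, rfl⟩ := ha
        obtain ⟨y, -, rfl⟩ := hb
        exact Set.disjoint_singleton.2 fun h => hab (h ▸ rfl))
    rw [Finset.sum_image fun _ _ _ _ h => Set.singleton_injective h] at h
    simpa [pointMeasure_singleton] using h

open scoped VectorMeasure in
theorem integral_pointMeasure (c : X →₀ ℝ) (f : X → ℝ) :
    ∫ᵛ x, f x ∂•(pointMeasure c) = ∑ x ∈ c.support, f x * c x := by
  rw [pointMeasure, VectorMeasure.integral_finsetSum_vectorMeasure]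
  · simp [VectorMeasure.integral_dirac]
  · intro x _
    rw [VectorMeasure.Integrable, VectorMeasure.variation_dirac]
    exact (integrable_dirac (by simp)).smul_measure enorm_ne_top

theorem finSupp_pointMeasure [TopologicalSpace X] (c : X →₀ ℝ) :
    finSupp (pointMeasure c) = c.support := by
  ext x
  simp [finSupp, pointMeasure_singleton]

end PointMeasure

/-! ### Separation by clopen sets in Stone spaces -/

namespace StoneSpace

variable {α : Type*} [BooleanAlgebra α]

theorem inf_mem_iff (u : StoneSpace α) {a b : α} :
    a ⊓ b ∈ u.carrier ↔ a ∈ u.carrier ∧ b ∈ u.carrier :=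
  ⟨fun h => ⟨u.mem_of_le h inf_le_left, u.mem_of_le h inf_le_right⟩, fun h => u.inf_mem h.1 h.2⟩

theorem sup_mem_iff (u : StoneSpace α) {a b : α} :
    a ⊔ b ∈ u.carrier ↔ a ∈ u.carrier ∨ b ∈ u.carrier := by
  rw [← not_iff_not, ← u.compl_mem_iff, compl_sup, inf_mem_iff, u.compl_mem_iff, u.compl_mem_iff,
    not_or]

theorem sdiff_mem_iff (u : StoneSpace α) {a b : α} :
    a \ b ∈ u.carrier ↔ a ∈ u.carrier ∧ b ∉ u.carrier := by
  rw [sdiff_eq, inf_mem_iff, compl_mem_iff]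

theorem finset_sup_mem_iff {ι : Type*} (u : StoneSpace α) (s : Finset ι) (a : ι → α) :
    s.sup a ∈ u.carrier ↔ ∃ i ∈ s, a i ∈ u.carrier := by
  classical
  induction s using Finset.induction_on with
  | empty => simp [u.bot_notMem]
  | insert i s _ ih => simp [sup_mem_iff, ih]

theorem exists_mem_notMem {u v : StoneSpace α} (h : u ≠ v) :
    ∃ a, a ∈ u.carrier ∧ a ∉ v.carrier := by
  by_contra! H
  refine h (StoneSpace.ext (Set.Subset.antisymm H fun a ha => ?_))
  by_contra hau
  exact (v.compl_mem_iff a).1 (H _ ((u.compl_mem_iff a).2 hau)) ha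

theorem exists_mem_forall_notMem (u : StoneSpace α) (F : Finset (StoneSpace α)) (h : u ∉ F) :
    ∃ a ∈ u.carrier, ∀ v ∈ F, a ∉ v.carrier := by
  classical
  induction F using Finset.induction_on with
  | empty => exact ⟨⊤, u.top_mem, by simp⟩
  | insert v F _ ih =>
    rw [Finset.mem_insert, not_or] at h
    obtain ⟨a, ha, haF⟩ := ih h.2
    obtain ⟨b, hb, hbv⟩ := exists_mem_notMem h.1
    refine ⟨a ⊓ b, u.inf_mem ha hb, ?_⟩
    simp only [Finset.mem_insert, inf_mem_iff]
    rintro w (rfl | hw)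
    · exact fun h => hbv h.2
    · exact fun h => haF w hw h.1

theorem exists_forall_mem_forall_notMem (G F : Finset (StoneSpace α)) (h : Disjoint G F) :
    ∃ a, (∀ u ∈ G, a ∈ u.carrier) ∧ ∀ v ∈ F, a ∉ v.carrier := by
  classical
  induction G using Finset.induction_on with
  | empty => exact ⟨⊥, by simp, fun v _ => v.bot_notMem⟩
  | insert u G _ ih =>
    rw [Finset.disjoint_insert_left] at h
    obtain ⟨a, ha, haF⟩ := ih h.2
    obtain ⟨b, hb, hbF⟩ := u.exists_mem_forall_notMem F h.1
    refine ⟨a ⊔ b, ?_, fun v hv => ?_⟩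
    · simp only [Finset.mem_insert, sup_mem_iff]
      rintro w (rfl | hw)
      exacts [Or.inr hb, Or.inl (ha w hw)]
    · rw [sup_mem_iff, not_or]
      exact ⟨haF v hv, hbF v hv⟩

/-- Finitely many pairwise disjoint finite sets have pairwise disjoint clopen neighbourhoods. -/
theorem exists_pairwise_disjoint {ι : Type*} (s : Finset ι) (F : ι → Finset (StoneSpace α))
    (hF : Pairwise fun i j => Disjoint (F i) (F j)) :
    ∃ a : ι → α, (∀ i ∈ s, ∀ j ∈ s, i ≠ j → Disjoint (a i) (a j)) ∧
      ∀ i ∈ s, ∀ u ∈ F i, a i ∈ u.carrier := by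
  classical
  have h (i : ι) : ∃ b, (∀ u ∈ F i, b ∈ u.carrier) ∧
      ∀ v ∈ (s.erase i).biUnion F, b ∉ v.carrier := by
    refine exists_forall_mem_forall_notMem _ _ ?_
    rw [Finset.disjoint_biUnion_right]
    exact fun j hj => hF (Finset.ne_of_mem_erase hj).symm
  choose b hb hb' using h
  -- Removing the other `b j` forces disjointness and loses no point of `F i`, since each of them
  -- avoids `F i`.
  refine ⟨fun i => b i \ (s.erase i).sup b, fun i hi j hj hij => ?_, fun i hi u hu => ?_⟩
  · exact ((disjoint_sdiff_self_right (x := b i) (y := b j)).mono_left sdiff_le).mono_right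
      (sdiff_le_sdiff_left (Finset.le_sup (f := b) (Finset.mem_erase.2 ⟨hij, hi⟩)))
  · rw [sdiff_mem_iff, finset_sup_mem_iff]
    refine ⟨hb i u hu, ?_⟩
    rintro ⟨j, hj, hju⟩
    rw [Finset.mem_erase] at hj
    exact hb' j u (Finset.mem_biUnion.2 ⟨i, Finset.mem_erase.2 ⟨hj.1.symm, hi⟩, hu⟩) hju

theorem isClopen_basicClopen (a : α) : IsClopen (basicClopen a) := by
  refine ⟨⟨?_⟩, isOpen_basicClopen a⟩
  have : (basicClopen a)ᶜ = basicClopen aᶜ := by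
    ext u
    exact (u.compl_mem_iff a).symm
  rw [this]
  exact isOpen_basicClopen _

theorem exists_basicClopen_subset {U : Set (StoneSpace α)} (hU : IsOpen U) {u : StoneSpace α}
    (hu : u ∈ U) : ∃ a ∈ u.carrier, basicClopen a ⊆ U := by
  induction hU with
  | basic s hs =>
    obtain ⟨a, rfl⟩ := hs
    exact ⟨a, hu, subset_rfl⟩
  | univ => exact ⟨⊤, u.top_mem, Set.subset_univ _⟩
  | inter s t _ _ hs ht =>
    obtain ⟨a, ha, has⟩ := hs hu.1
    obtain ⟨b, hb, hbt⟩ := ht hu.2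
    exact ⟨a ⊓ b, u.inf_mem ha hb, fun v hv =>
      ⟨has (v.inf_mem_iff.1 hv).1, hbt (v.inf_mem_iff.1 hv).2⟩⟩
  | sUnion S _ ih =>
    obtain ⟨s, hs, hus⟩ := hu
    obtain ⟨a, ha, has⟩ := ih s hs hus
    exact ⟨a, ha, has.trans (Set.subset_sUnion_of_mem hs)⟩

/-- The value at the clopen set `[a]` of the measure `∑ c u • δ_u`. -/
def mass (c : StoneSpace α →₀ ℝ) (a : α) : ℝ :=
  open scoped Classical in c.sum fun u r => if a ∈ u.carrier then r else 0

open scoped Classical in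
theorem mass_eq_sum {c : StoneSpace α →₀ ℝ} {T : Finset (StoneSpace α)} (h : c.support ⊆ T)
    (a : α) : mass c a = ∑ u ∈ T, if a ∈ u.carrier then c u else 0 :=
  Finsupp.sum_of_support_subset _ h _ (by simp)

theorem mass_sub (c d : StoneSpace α →₀ ℝ) (a : α) : mass (c - d) a = mass c a - mass d a := by
  classical
  refine Finsupp.sum_sub_index fun u r s => ?_
  split_ifs <;> simp

end StoneSpace

/-! ### Norms and masses of clopen sets -/

/-- The `ℓ¹`-norm of a finitely supported function. -/
def l1Norm {X : Type*} (c : X →₀ ℝ) : ℝ := c.sum fun _ r => |r|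

theorem l1Norm_eq_sum {X : Type*} {c : X →₀ ℝ} {T : Finset X} (h : c.support ⊆ T) :
    l1Norm c = ∑ x ∈ T, |c x| :=
  Finsupp.sum_of_support_subset _ h _ (by simp)

/-- Half of the `ℓ¹`-norm on a finite set is carried by the points where the sign is constant. -/
theorem exists_subset_half_le_abs_sum {X : Type*} (F : Finset X) (c : X → ℝ) :
    ∃ G ⊆ F, (∑ x ∈ F, |c x|) / 2 ≤ |∑ x ∈ G, c x| := by
  classical
  have h : ∑ x ∈ F, |c x| = |∑ x ∈ F with 0 ≤ c x, c x| + |∑ x ∈ F with ¬ 0 ≤ c x, c x| := by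
    rw [← Finset.sum_filter_add_sum_filter_not F (fun x => 0 ≤ c x), Finset.abs_sum_of_nonneg,
      ← abs_neg (∑ x ∈ F with ¬ 0 ≤ c x, c x), ← Finset.sum_neg_distrib, Finset.abs_sum_of_nonneg]
    · congr 1 <;> refine Finset.sum_congr rfl fun x hx => ?_
      · exact abs_of_nonneg (Finset.mem_filter.1 hx).2
      · exact abs_of_neg (not_le.1 (Finset.mem_filter.1 hx).2)
    · exact fun x hx => neg_nonneg.2 (not_le.1 (Finset.mem_filter.1 hx).2).le
    · exact fun x hx => (Finset.mem_filter.1 hx).2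
  by_cases h1 : (∑ x ∈ F, |c x|) / 2 ≤ |∑ x ∈ F with 0 ≤ c x, c x|
  · exact ⟨_, Finset.filter_subset _ _, h1⟩
  · exact ⟨{x ∈ F | ¬ 0 ≤ c x}, Finset.filter_subset _ _, by linarith⟩

namespace StoneSpace

variable {α : Type*} [BooleanAlgebra α]

theorem abs_mass_le (c : StoneSpace α →₀ ℝ) (a : α) : |mass c a| ≤ l1Norm c := by
  classical
  rw [mass_eq_sum subset_rfl, l1Norm_eq_sum subset_rfl]
  refine (Finset.abs_sum_le_sum_abs _ _).trans (Finset.sum_le_sum fun u _ => ?_)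
  split_ifs <;> simp

/-- A clopen set can cut out of the support exactly the points of the dominant sign. With
`abs_mass_le`, this makes the supremum of the masses equivalent to the norm. -/
theorem exists_half_le_abs_mass (c : StoneSpace α →₀ ℝ) : ∃ a, l1Norm c / 2 ≤ |mass c a| := by
  classical
  obtain ⟨G, hG, h⟩ := exists_subset_half_le_abs_sum c.support c
  obtain ⟨a, ha, ha'⟩ := exists_forall_mem_forall_notMem G (c.support \ G) Finset.disjoint_sdiff
  refine ⟨a, ?_⟩
  rw [l1Norm_eq_sum subset_rfl, mass_eq_sum subset_rfl, ← Finset.sum_filter]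
  convert h using 3
  ext u
  simp only [Finset.mem_filter]
  refine ⟨fun hu => ?_, fun hu => ⟨hG hu, ha u hu⟩⟩
  by_contra hG'
  exact ha' u (Finset.mem_sdiff.2 ⟨hu.1, hG'⟩) hu.2

theorem sum_abs_le_l1Norm {X : Type*} (c : X →₀ ℝ) (T : Finset X) : ∑ x ∈ T, |c x| ≤ l1Norm c := by
  classical
  rw [l1Norm_eq_sum (T := T ∪ c.support) Finset.subset_union_right]
  exact Finset.sum_le_sum_of_subset_of_nonneg Finset.subset_union_left fun _ _ _ => abs_nonneg _

/-! ### Pointwise null subsequences and the gliding hump -/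

/-- Every bounded sequence of finitely supported functions has a pointwise convergent
subsequence. -/
theorem exists_pointwise_convergent_subseq {X : Type*} (c : ℕ → X →₀ ℝ)
    (hc : ∀ n, l1Norm (c n) ≤ 1) :
    ∃ φ : ℕ → ℕ, StrictMono φ ∧ ∀ x, ∃ l, Tendsto (fun n => c (φ n) x) atTop (𝓝 l) := by
  -- All terms vanish off this countable set, so sequential compactness of the countable power of
  -- [-1, 1] suffices.
  set S : Set X := ⋃ n, (c n).support with hS
  have : Countable S := (Set.countable_iUnion fun n => (c n).support.countable_toSet).to_subtype
  have hK : IsCompact (Set.univ.pi fun _ : S => Set.Icc (-1 : ℝ) 1) :=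
    isCompact_univ_pi fun _ => isCompact_Icc
  obtain ⟨l, -, φ, hφ, hl⟩ := hK.tendsto_subseq (x := fun n (x : S) => c n x) fun n x _ => by
    refine abs_le.1 ?_
    simpa using (sum_abs_le_l1Norm (c n) {x.1}).trans (hc n)
  refine ⟨φ, hφ, fun x => ?_⟩
  by_cases hx : x ∈ S
  · exact ⟨l ⟨x, hx⟩, tendsto_pi_nhds.1 hl ⟨x, hx⟩⟩
  · refine ⟨0, tendsto_const_nhds.congr fun n => ?_⟩
    simp only [hS, Set.mem_iUnion, Finset.mem_coe, Finsupp.mem_support_iff, not_exists,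
      not_not] at hx
    exact (hx _).symm

/-- Taking differences makes a bounded weakly null sequence pointwise null. -/
theorem exists_pointwise_null (c : ℕ → StoneSpace α →₀ ℝ) (m : ℕ) (hc : ∀ n, l1Norm (c n) = 1)
    (hm : ∀ n, (c n).support.card ≤ m) (h0 : ∀ a, Tendsto (fun n => mass (c n) a) atTop (𝓝 0)) :
    ∃ θ : ℕ → StoneSpace α →₀ ℝ, (∀ n, 1 / 4 ≤ l1Norm (θ n)) ∧ (∀ n, (θ n).support.card ≤ 2 * m) ∧
      (∀ a, Tendsto (fun n => mass (θ n) a) atTop (𝓝 0)) ∧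
      ∀ x, Tendsto (fun n => θ n x) atTop (𝓝 0) := by
  classical
  obtain ⟨φ, hφ, hl⟩ := exists_pointwise_convergent_subseq c fun n => (hc n).le
  have h0' (a : α) : Tendsto (fun n => mass (c (φ n)) a) atTop (𝓝 0) :=
    (h0 a).comp hφ.tendsto_atTop
  -- Some clopen set sees half of the norm of the n-th term but less than 1/4 of a late term, so
  -- their difference has norm at least 1/2 - 1/4.
  have key (n : ℕ) : ∃ k ≥ n, 1 / 4 ≤ l1Norm (c (φ n) - c (φ k)) := by
    obtain ⟨a, ha⟩ := exists_half_le_abs_mass (c (φ n))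
    have h1 : ∀ᶠ k in atTop, |mass (c (φ k)) a| < 1 / 4 := by
      have := (h0' a).abs
      rw [abs_zero] at this
      exact this.eventually_lt_const (by norm_num)
    obtain ⟨k, hk, hkn⟩ := (h1.and (eventually_ge_atTop n)).exists
    refine ⟨k, hkn, ?_⟩
    have h2 := abs_mass_le (c (φ n) - c (φ k)) a
    rw [mass_sub] at h2
    have h3 := abs_sub_abs_le_abs_sub (mass (c (φ n)) a) (mass (c (φ k)) a)
    rw [hc] at ha
    linarith
  choose g hg hg' using key
  have hgt : Tendsto g atTop atTop := tendsto_atTop_mono hg tendsto_id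
  refine ⟨fun n => c (φ n) - c (φ (g n)), hg', fun n => ?_, fun a => ?_, fun x => ?_⟩
  · refine (Finset.card_le_card Finsupp.support_sub).trans ((Finset.card_union_le _ _).trans ?_)
    linarith [hm (φ n), hm (φ (g n))]
  · simpa [mass_sub] using (h0' a).sub ((h0' a).comp hgt)
  · obtain ⟨l, hl⟩ := hl x
    simpa using hl.sub (hl.comp hgt)

/-- A gliding hump: a pointwise null sequence is, up to small errors, disjointly supported along a
subsequence. -/
theorem exists_gliding_hump {X : Type*} [DecidableEq X] (θ : ℕ → X →₀ ℝ)
    (hθ : ∀ x, Tendsto (fun n => θ n x) atTop (𝓝 0)) {ε : ℝ} (hε : 0 < ε) :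
    ∃ (n : ℕ → ℕ) (F : ℕ → Finset X), StrictMono n ∧ (Pairwise fun i j => Disjoint (F i) (F j)) ∧
      ∀ k, F k ⊆ (θ (n k)).support ∧
        ∑ x ∈ (θ (n k)).support \ F k, |θ (n k) x| ≤ ε := by
  obtain ⟨f, hf, hr⟩ := exists_seq_of_forall_finset_exists
    (P := fun p : ℕ × Finset X => p.2 ⊆ (θ p.1).support ∧
      ∑ x ∈ (θ p.1).support \ p.2, |θ p.1 x| ≤ ε)
    (r := fun p q => p.1 < q.1 ∧ Disjoint p.2 q.2) (by
      intro s _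
      -- The finite set used by the earlier humps: a late term has mass at most ε on it, and the
      -- rest of its support is the next hump.
      set E : Finset X := s.biUnion Prod.snd
      have hE : Tendsto (fun n => ∑ x ∈ E, |θ n x|) atTop (𝓝 0) := by
        simpa using tendsto_finsetSum E fun x _ => (hθ x).abs
      obtain ⟨n, hn, hns⟩ :=
        ((hE.eventually_le_const hε).and (eventually_gt_atTop (s.sup Prod.fst))).exists
      refine ⟨(n, (θ n).support \ E), ⟨Finset.sdiff_subset, ?_⟩,
        fun p hp => ⟨(Finset.le_sup (f := Prod.fst) hp).trans_lt hns, ?_⟩⟩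
      · refine (Finset.sum_le_sum_of_subset_of_nonneg (fun x hx => ?_)
          fun _ _ _ => abs_nonneg _).trans hn
        simp only [Finset.mem_sdiff, not_and, not_not] at hx
        exact hx.2 hx.1
      · exact Finset.disjoint_sdiff.mono_left (Finset.subset_biUnion_of_mem Prod.snd hp))
  refine ⟨fun k => (f k).1, fun k => (f k).2, strictMono_nat_of_lt_succ fun k =>
    (hr k (k + 1) k.lt_succ_self).1, fun i j hij => ?_, hf⟩
  rcases hij.lt_or_gt with h | h
  exacts [(hr i j h).2, (hr j i h).2.symm]

end StoneSpace

/-! ### Sets of density zero and Cesàro means -/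

theorem HasAsympDensity.mono_zero {A B : Set ℕ} (hB : HasAsympDensity B 0) (h : A ⊆ B) :
    HasAsympDensity A 0 := by
  refine squeeze_zero (fun n => by positivity) (fun n => ?_) hB
  have : (A ∩ Set.Iio n).ncard ≤ (B ∩ Set.Iio n).ncard :=
    Set.ncard_le_ncard (Set.inter_subset_inter_left _ h) ((Set.finite_Iio n).inter_of_right _)
  gcongr

theorem HasAsympDensity.of_finite {A : Set ℕ} (hA : A.Finite) : HasAsympDensity A 0 := by
  refine squeeze_zero (fun n => by positivity) (fun n => ?_)
    (tendsto_const_div_atTop_nhds_zero_nat (A.ncard : ℝ))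
  have : (A ∩ Set.Iio n).ncard ≤ A.ncard := Set.ncard_le_ncard Set.inter_subset_left hA
  gcongr

/-- A countable union of sets of density zero has density zero if their upper densities, uniformly
in the length of the initial segment, are summable. -/
theorem HasAsympDensity.iUnion {A : ℕ → Set ℕ} {δ : ℕ → ℝ} (hA : ∀ i, HasAsympDensity (A i) 0)
    (hδ : ∀ i n, ((A i ∩ Set.Iio n).ncard : ℝ) ≤ δ i * n) (hs : Summable δ) :
    HasAsympDensity (⋃ i, A i) 0 := by
  have hb (i n : ℕ) : ((A i ∩ Set.Iio n).ncard : ℝ) / n ≤ δ i := by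
    have h0 : 0 ≤ δ i := by
      have := (Nat.cast_nonneg _).trans (hδ i 1)
      simpa using this
    exact div_le_of_le_mul₀ (by positivity) h0 (hδ i n)
  -- The sum over i of the relative sizes tends to zero, with δ as dominating sequence. It bounds
  -- the relative size of the union because finitely many `A i` cover its part below n.
  have hlim := tendsto_tsum_of_dominated_convergence (𝓕 := atTop)
    (f := fun n i => ((A i ∩ Set.Iio n).ncard : ℝ) / n) (g := fun _ => 0) hs hA
    (Eventually.of_forall fun n i => by
      rw [Real.norm_of_nonneg (by positivity)]
      exact hb i n)
  rw [tsum_zero] at hlim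
  refine squeeze_zero (fun n => by positivity) (fun n => ?_) hlim
  have hsum : Summable fun i => ((A i ∩ Set.Iio n).ncard : ℝ) / n :=
    hs.of_nonneg_of_le (fun i => by positivity) fun i => hb i n
  have hf (x : ℕ) : ∃ i, x ∈ ⋃ i, A i → x ∈ A i := by
    by_cases hx : x ∈ ⋃ i, A i
    · obtain ⟨i, hi⟩ := Set.mem_iUnion.1 hx
      exact ⟨i, fun _ => hi⟩
    · exact ⟨0, fun h => (hx h).elim⟩
  choose f hf using hf
  set I := (Finset.range n).image f
  have h1 : ((⋃ i, A i) ∩ Set.Iio n).ncard ≤ ∑ i ∈ I, (A i ∩ Set.Iio n).ncard := by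
    refine le_trans (Set.ncard_le_ncard (fun x hx => ?_) ?_) (Finset.set_ncard_biUnion_le I _)
    · exact Set.mem_iUnion₂.2
        ⟨f x, Finset.mem_image_of_mem f (Finset.mem_range.2 hx.2), hf x hx.1, hx.2⟩
    · exact I.finite_toSet.biUnion fun i _ => (Set.finite_Iio n).inter_of_right _
  calc (((⋃ i, A i) ∩ Set.Iio n).ncard : ℝ) / n
      ≤ (∑ i ∈ I, ((A i ∩ Set.Iio n).ncard : ℝ)) / n := by
        gcongr
        exact_mod_cast h1
    _ = ∑ i ∈ I, ((A i ∩ Set.Iio n).ncard : ℝ) / n := Finset.sum_div _ _ _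
    _ ≤ _ := hsum.sum_le_tsum _ fun i _ => by positivity

/-- Bounded sequences converging to zero along a set of density one are Cesàro null. -/
theorem tendsto_cesaro_zero_of_density {g : ℕ → ℝ} {C : ℝ} (hC : ∀ i, |g i| ≤ C)
    (hg : ∀ η > 0, HasAsympDensity {i | η ≤ |g i|} 0) :
    Tendsto (fun n : ℕ => (∑ i ∈ Finset.range n, g i) / n) atTop (𝓝 0) := by
  classical
  have hC0 : 0 ≤ C := (abs_nonneg _).trans (hC 0)
  rw [Metric.tendsto_atTop']
  intro ε hε
  -- Terms outside `S` contribute less than ε/2 each; those in `S` are bounded by `C` and have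
  -- density zero.
  set S : Set ℕ := {i | ε / 2 ≤ |g i|} with hS
  have h1 := ((hg (ε / 2) (half_pos hε)).const_mul C).eventually_lt_const
    (show C * 0 < ε / 2 by simpa using half_pos hε)
  obtain ⟨N, hN⟩ := eventually_atTop.1 h1
  refine ⟨N, fun n hn => ?_⟩
  have hn0 : (0 : ℝ) < n := by exact_mod_cast (Nat.zero_le N).trans_lt hn
  have hcard : ((S ∩ Set.Iio n).ncard : ℝ) = ∑ i ∈ Finset.range n, if i ∈ S then 1 else 0 := by
    rw [Finset.sum_boole]
    congr 1
    rw [← Set.ncard_coe_finset]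
    congr 1
    ext i
    simp [and_comm]
  have h2 : |∑ i ∈ Finset.range n, g i| ≤ n * (ε / 2) + C * (S ∩ Set.Iio n).ncard := by
    rw [hcard, Finset.mul_sum]
    refine (Finset.abs_sum_le_sum_abs _ _).trans ?_
    have : (n : ℝ) * (ε / 2) = ∑ i ∈ Finset.range n, ε / 2 := by simp
    rw [this, ← Finset.sum_add_distrib]
    refine Finset.sum_le_sum fun i _ => ?_
    split_ifs with h
    · linarith [hC i]
    · rw [hS, Set.mem_ofPred_eq, not_le] at h
      linarith
  rw [dist_zero_right, Real.norm_eq_abs, abs_div, abs_of_pos hn0, div_lt_iff₀ hn0]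
  have h3 := hN n hn.le
  rw [← mul_div_assoc, div_lt_iff₀ hn0] at h3
  linarith

/-! ### Ultrafilters on 𝒟 and small sets -/

namespace PlebanekAlgebra

open StoneSpace

/-- The ultrafilter of all sets of density one. -/
def densityOne : StoneSpace plebanekAlgebra where
  carrier := {a | HasAsympDensity (a : Set ℕ) 1}
  top_mem := by simpa using HasAsympDensity.empty.compl
  bot_notMem h := zero_ne_one (tendsto_nhds_unique HasAsympDensity.empty h)
  mem_of_le ha hab := HasAsympDensity.mono_one ha hab
  inf_mem {a b} ha hb := by
    have ha' := HasAsympDensity.compl ha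
    have hb' := HasAsympDensity.compl hb
    rw [sub_self] at ha' hb'
    simpa [Set.compl_union] using (ha'.union_zero hb').compl
  mem_or_compl_mem a := by
    rcases a.2 with h | h
    · right
      simpa using h.compl
    · exact Or.inl h

/-- The principal ultrafilter at `k`. -/
def principal (k : ℕ) : StoneSpace plebanekAlgebra where
  carrier := {a | k ∈ (a : Set ℕ)}
  top_mem := Set.mem_univ k
  bot_notMem h := h
  mem_of_le ha hab := hab ha
  inf_mem ha hb := ⟨ha, hb⟩
  mem_or_compl_mem _ := Classical.em _

/-- A set of density zero as an element of the algebra. -/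
def ofDensityZero (A : Set ℕ) (h : HasAsympDensity A 0) : plebanekAlgebra := ⟨A, Or.inl h⟩

theorem principal_injective : Function.Injective principal := fun i j h => by
  have : ofDensityZero {i} (.of_finite (Set.finite_singleton i)) ∈ (principal j).carrier := by
    rw [← h]
    exact Set.mem_singleton i
  exact (Set.mem_singleton_iff.1 this).symm

theorem principal_ne_densityOne (k : ℕ) : principal k ≠ densityOne := fun h => by
  have hk : HasAsympDensity {k} 0 := .of_finite (Set.finite_singleton k)
  have : ofDensityZero {k} hk ∈ densityOne.carrier := by
    rw [← h]
    exact Set.mem_singleton k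
  exact zero_ne_one (tendsto_nhds_unique hk this)

theorem exists_density_zero_mem {u : StoneSpace plebanekAlgebra} (hu : u ≠ densityOne) :
    ∃ a ∈ u.carrier, HasAsympDensity (a : Set ℕ) 0 := by
  obtain ⟨a, ha, ha'⟩ := exists_mem_notMem hu
  exact ⟨a, ha, a.2.resolve_right ha'⟩

theorem eq_principal {u : StoneSpace plebanekAlgebra} {k : ℕ}
    (h : ofDensityZero {k} (.of_finite (Set.finite_singleton k)) ∈ u.carrier) :
    u = principal k := by
  by_contra hne
  obtain ⟨a, ha, ha'⟩ := exists_mem_notMem hne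
  refine u.bot_notMem (u.mem_of_le (u.inf_mem h ha) ?_)
  rintro x ⟨rfl, hx⟩
  exact ha' hx

/-- A finite set is a finite join of singletons, so an ultrafilter containing it contains a
singleton and is principal. -/
theorem finite_notMem {u : StoneSpace plebanekAlgebra} (hu : ∀ k, u ≠ principal k) (N : ℕ) :
    ofDensityZero (Set.Iio N) (.of_finite (Set.finite_Iio N)) ∉ u.carrier := by
  intro h
  have : (Finset.range N).sup
      (fun k => ofDensityZero {k} (.of_finite (Set.finite_singleton k))) ∈ u.carrier := by
    refine u.mem_of_le h fun x hx => ?_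
    exact Finset.le_sup (f := fun k => ofDensityZero {k} (.of_finite (Set.finite_singleton k)))
      (Finset.mem_range.2 hx) (Set.mem_singleton x)
  rw [finset_sup_mem_iff] at this
  obtain ⟨k, -, hk⟩ := this
  exact hu k (eq_principal hk)

/-- `A` has density zero and relative size at most `δ` in each initial segment of `ℕ`. -/
def IsSmall (δ : ℝ) (A : Set ℕ) : Prop :=
  HasAsympDensity A 0 ∧ ∀ n : ℕ, ((A ∩ Set.Iio n).ncard : ℝ) ≤ δ * n

theorem IsSmall.mono {δ : ℝ} {A B : Set ℕ} (hB : IsSmall δ B) (h : A ⊆ B) : IsSmall δ A := by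
  refine ⟨hB.1.mono_zero h, fun n => le_trans ?_ (hB.2 n)⟩
  exact_mod_cast Set.ncard_le_ncard (Set.inter_subset_inter_left _ h)
    ((Set.finite_Iio n).inter_of_right _)

theorem IsSmall.union {δ ε : ℝ} {A B : Set ℕ} (hA : IsSmall δ A) (hB : IsSmall ε B) :
    IsSmall (δ + ε) (A ∪ B) := by
  refine ⟨hA.1.union_zero hB.1, fun n => ?_⟩
  rw [Set.union_inter_distrib_right, add_mul]
  refine le_trans ?_ (add_le_add (hA.2 n) (hB.2 n))
  exact_mod_cast Set.ncard_union_le _ _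

theorem IsSmall.le {δ ε : ℝ} {A : Set ℕ} (hA : IsSmall δ A) (h : δ ≤ ε) : IsSmall ε A :=
  ⟨hA.1, fun n => (hA.2 n).trans (by gcongr)⟩

theorem IsSmall.finset_sup {ι : Type*} {δ : ℝ} (s : Finset ι) (a : ι → plebanekAlgebra)
    (h : ∀ i ∈ s, IsSmall δ (a i)) : IsSmall (s.card * δ) (s.sup a : plebanekAlgebra) := by
  classical
  induction s using Finset.induction_on with
  | empty => exact ⟨HasAsympDensity.empty, fun n => by simp⟩
  | insert i s hi ih =>
    rw [Finset.sup_insert, Finset.card_insert_of_notMem hi]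
    have h1 := (h i (Finset.mem_insert_self i s)).union
      (ih fun j hj => h j (Finset.mem_insert_of_mem hj))
    refine IsSmall.le (h1.mono subset_rfl) (le_of_eq ?_)
    push_cast
    ring

/-- All but finitely many ultrafilters on the algebra contain a small set. -/
theorem exists_finset_forall_isSmall {δ : ℝ} (hδ : 0 < δ) :
    ∃ bad : Finset (StoneSpace plebanekAlgebra), ∀ u ∉ bad, ∃ a ∈ u.carrier,
      IsSmall δ (a : Set ℕ) := by
  classical
  obtain ⟨N, hN⟩ := exists_nat_gt (1 / δ)
  rw [div_lt_iff₀ hδ] at hN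
  -- For k ≥ N > 1/δ the singleton {k} is small: it meets {0, …, n - 1} only if n > N, and then in
  -- one point.
  refine ⟨insert densityOne ((Finset.range N).image principal), fun u hu => ?_⟩
  simp only [Finset.mem_insert, Finset.mem_image, Finset.mem_range, not_or, not_exists,
    not_and] at hu
  by_cases hp : ∃ k, u = principal k
  · obtain ⟨k, rfl⟩ := hp
    have hk : N ≤ k := not_lt.1 fun h => hu.2 k h rfl
    refine ⟨ofDensityZero {k} (.of_finite (Set.finite_singleton k)), Set.mem_singleton k,
      .of_finite (Set.finite_singleton k), fun n => ?_⟩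
    change ((({k} : Set ℕ) ∩ Set.Iio n).ncard : ℝ) ≤ δ * n
    by_cases hkn : k < n
    · have h1 : (({k} : Set ℕ) ∩ Set.Iio n).ncard ≤ 1 := by
        simpa using Set.ncard_le_ncard (Set.inter_subset_left (s := {k}) (t := Set.Iio n))
      have h2 : (N : ℝ) ≤ n := by exact_mod_cast hk.trans hkn.le
      calc _ ≤ (1 : ℝ) := by exact_mod_cast h1
        _ ≤ N * δ := hN.le
        _ ≤ δ * n := by rw [mul_comm]; gcongr
    · have : ({k} : Set ℕ) ∩ Set.Iio n = ∅ := by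
        ext x
        simp only [Set.mem_inter_iff, Set.mem_singleton_iff, Set.mem_Iio, Set.mem_empty_iff_false,
          iff_false, not_and]
        rintro rfl
        exact hkn
      rw [this]
      simp only [Set.ncard_empty, Nat.cast_zero]
      positivity
  · push Not at hp
    obtain ⟨a, ha, ha0⟩ := exists_density_zero_mem hu.1
    -- Beyond `K` the relative size of `a` is at most δ. Deleting the numbers below `K` makes this
    -- hold for every n, and a nonprincipal ultrafilter does not notice.
    obtain ⟨K, hK⟩ := eventually_atTop.1 (ha0.eventually_le_const hδ)
    refine ⟨a \ ofDensityZero (Set.Iio K) (.of_finite (Set.finite_Iio K)),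
      u.sdiff_mem_iff.2 ⟨ha, finite_notMem hp K⟩, ha0.mono_zero sdiff_le, fun n => ?_⟩
    change ((((a : Set ℕ) \ Set.Iio K) ∩ Set.Iio n).ncard : ℝ) ≤ δ * n
    rcases le_or_gt K n with h | h
    · rcases n.eq_zero_or_pos with rfl | hn
      · simp
      · have h1 := hK n h
        rw [div_le_iff₀ (by exact_mod_cast hn)] at h1
        refine le_trans ?_ h1
        exact_mod_cast Set.ncard_le_ncard (Set.inter_subset_inter_left _ Set.sdiff_subset)
          ((Set.finite_Iio n).inter_of_right _)
    · have : ((a : Set ℕ) \ Set.Iio K) ∩ Set.Iio n = ∅ := by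
        ext x
        simp only [Set.mem_inter_iff, Set.mem_sdiff, Set.mem_Iio, Set.mem_empty_iff_false, iff_false]
        omega
      rw [this]
      simp only [Set.ncard_empty, Nat.cast_zero]
      positivity

end PlebanekAlgebra

/-! ### Bounded supports: disjoint neighbourhoods and the contradiction -/

namespace PlebanekAlgebra

open StoneSpace

/-- Along a nonprincipal ultrafilter, some member of a disjoint sequence of finite sets of bounded
size has a small clopen neighbourhood that misses almost all members of the sequence. -/
theorem exists_isSmall_neighbourhood {F : ℕ → Finset (StoneSpace plebanekAlgebra)} {M : ℕ}
    (hF : Pairwise fun i j => Disjoint (F i) (F j)) (hM : ∀ i, (F i).card ≤ M) {δ : ℝ}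
    (hδ : 0 < δ) {Q : ℕ → Prop} (hQ : ∀ᶠ j in (hyperfilter ℕ : Filter ℕ), Q j) :
    ∃ k, Q k ∧ ∃ a : plebanekAlgebra, IsSmall δ (a : Set ℕ) ∧ (∀ u ∈ F k, a ∈ u.carrier) ∧
      ∀ᶠ j in (hyperfilter ℕ : Filter ℕ), ∀ u ∈ F j, a ∉ u.carrier := by
  classical
  -- The denominator M + 1 leaves room for a union of one small set for each of at most M points. By
  -- disjointness each bad point spoils at most one `F j`.
  obtain ⟨bad, hbad⟩ := exists_finset_forall_isSmall (δ := δ / (M + 1)) (by positivity)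
  have hfin : {j | ¬ ∀ u ∈ F j, u ∉ bad}.Finite := by
    have : {j | ¬ ∀ u ∈ F j, u ∉ bad} = ⋃ u ∈ bad, {j | u ∈ F j} := by
      ext j
      simp [and_comm]
    rw [this]
    refine bad.finite_toSet.biUnion fun u _ => Set.Subsingleton.finite fun i hi j hj => ?_
    by_contra hij
    exact Finset.disjoint_left.1 (hF hij) hi hj
  have hQ' : {j | Q j ∧ ∀ u ∈ F j, u ∉ bad}.Infinite := by
    intro hfin'
    have h1 := hfin'.compl_mem_hyperfilter
    have h2 := hfin.compl_mem_hyperfilter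
    obtain ⟨j, hj, hj1, hj2⟩ := (hQ.and (Filter.inter_mem h1 h2)).exists
    exact hj1 ⟨hj, not_not.1 hj2⟩
  obtain ⟨s, hs, hsc⟩ := hQ'.exists_subset_card_eq (M + 1)
  obtain ⟨a, hadisj, ha⟩ := exists_pairwise_disjoint s F hF
  -- If `F j` met all M + 1 of the sets `a i`, one of its at most M points would lie in two of them.
  have hmiss (j : ℕ) : ∃ i ∈ (s : Set ℕ), ∀ u ∈ F j, a i ∉ u.carrier := by
    by_contra! h
    have : Nonempty (StoneSpace plebanekAlgebra) := ⟨densityOne⟩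
    choose! f hf hfa using h
    obtain ⟨i, hi, i', hi', hne, heq⟩ := Finset.exists_ne_map_eq_of_card_lt_of_maps_to
      (s := s) (t := F j) (f := f) (by rw [hsc]; exact Nat.lt_succ_of_le (hM j))
      (fun i hi => hf i hi)
    refine (f i).bot_notMem ?_
    rw [← (hadisj i hi i' hi' hne).eq_bot]
    exact (f i).inf_mem (hfa i hi) (heq ▸ hfa i' hi')
  -- The missed index depends on j but has finitely many values, so the ultrafilter fixes one for
  -- almost all j.
  obtain ⟨i, hi, hia⟩ := (Ultrafilter.eventually_exists_mem_iff s.finite_toSet).1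
    (Eventually.of_forall hmiss : ∀ᶠ j in (hyperfilter ℕ : Filter ℕ), _)
  refine ⟨i, (hs hi).1, ?_⟩
  have hb (u : StoneSpace plebanekAlgebra) : ∃ b : plebanekAlgebra, u ∈ F i →
      b ∈ u.carrier ∧ IsSmall (δ / (M + 1)) (b : Set ℕ) := by
    by_cases hu : u ∈ F i
    · obtain ⟨b, hb⟩ := hbad u ((hs hi).2 u hu)
      exact ⟨b, fun _ => hb⟩
    · exact ⟨⊥, fun h => (hu h).elim⟩
  choose b hb using hb
  refine ⟨a i ⊓ (F i).sup b, ?_, fun u hu => ?_, ?_⟩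
  · refine IsSmall.le ((IsSmall.finset_sup (F i) b fun u hu => (hb u hu).2).mono
      (inf_le_right : a i ⊓ (F i).sup b ≤ (F i).sup b)) ?_
    have : ((F i).card : ℝ) ≤ M + 1 := by exact_mod_cast (hM i).trans (Nat.le_succ M)
    calc ((F i).card : ℝ) * (δ / (M + 1)) ≤ (M + 1) * (δ / (M + 1)) := by gcongr
      _ = δ := by field_simp
  · exact u.inf_mem (ha i hi u hu) ((finset_sup_mem_iff _ _ _).2 ⟨u, hu, (hb u hu).1⟩)
  · filter_upwards [hia] with j hj u hu h
    exact hj u hu (u.inf_mem_iff.1 h).1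

/-- A disjoint sequence of finite sets of bounded size has a subsequence with pairwise disjoint
clopen neighbourhoods whose union is given by a set of density zero. -/
theorem exists_disjoint_neighbourhoods {F : ℕ → Finset (StoneSpace plebanekAlgebra)} {M : ℕ}
    (hF : Pairwise fun i j => Disjoint (F i) (F j)) (hM : ∀ i, (F i).card ≤ M) :
    ∃ (k : ℕ → ℕ) (a : ℕ → plebanekAlgebra), StrictMono k ∧
      (Pairwise fun i j => Disjoint (a i) (a j)) ∧ (∀ i, ∀ u ∈ F (k i), a i ∈ u.carrier) ∧
      HasAsympDensity (⋃ i, (a i : Set ℕ)) 0 := by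
  -- Triples of an index, a neighbourhood and its smallness bound. Each neighbourhood misses `F j`
  -- for almost all j along one fixed ultrafilter, so a next index avoiding all earlier ones always
  -- exists; halving the bounds makes them summable.
  obtain ⟨f, hf, hr⟩ := exists_seq_of_forall_finset_exists
    (P := fun t : ℕ × plebanekAlgebra × ℝ => 0 < t.2.2 ∧ IsSmall t.2.2 (t.2.1 : Set ℕ) ∧
      (∀ u ∈ F t.1, t.2.1 ∈ u.carrier) ∧
      ∀ᶠ j in (hyperfilter ℕ : Filter ℕ), ∀ u ∈ F j, t.2.1 ∉ u.carrier)
    (r := fun s t => s.1 < t.1 ∧ Disjoint s.2.1 t.2.1 ∧ t.2.2 ≤ 1 / 2 * s.2.2) (by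
      intro T hT
      obtain ⟨δ, hδT, hδ⟩ : ∃ δ : ℝ, (∀ t ∈ T, δ ≤ 1 / 2 * t.2.2) ∧ 0 < δ := by
        have h1 : ∀ᶠ δ : ℝ in 𝓝[>] 0, ∀ t ∈ T, δ ≤ 1 / 2 * t.2.2 := by
          rw [Filter.eventually_all_finset]
          intro t ht
          have : (0 : ℝ) < 1 / 2 * t.2.2 := by linarith [(hT t ht).1]
          exact (eventually_le_nhds this).filter_mono nhdsWithin_le_nhds
        exact (h1.and self_mem_nhdsWithin).exists
      have hQ : ∀ᶠ j in (hyperfilter ℕ : Filter ℕ),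
          ∀ t ∈ T, t.1 < j ∧ ∀ u ∈ F j, t.2.1 ∉ u.carrier := by
        rw [Filter.eventually_all_finset]
        intro t ht
        refine Filter.Eventually.and ?_ (hT t ht).2.2.2
        exact Nat.hyperfilter_le_atTop (eventually_gt_atTop t.1)
      obtain ⟨k, hk, a, has, hak, ha⟩ := exists_isSmall_neighbourhood hF hM hδ hQ
      -- Removing the earlier neighbourhoods keeps every point of `F k`, which they all miss.
      have hle : a \ T.sup (fun t => t.2.1) ≤ a := sdiff_le
      refine ⟨(k, a \ T.sup fun t => t.2.1, δ), ⟨hδ, has.mono hle, fun u hu => ?_, ?_⟩,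
        fun t ht => ⟨(hk t ht).1, ?_, hδT t ht⟩⟩
      · rw [sdiff_mem_iff, finset_sup_mem_iff]
        exact ⟨hak u hu, fun ⟨t, ht, htu⟩ => (hk t ht).2 u hu htu⟩
      · filter_upwards [ha] with j hj u hu h
        exact hj u hu (u.mem_of_le h hle)
      · exact disjoint_sdiff_self_right.mono_left (Finset.le_sup (f := fun t => t.2.1) ht))
  refine ⟨fun i => (f i).1, fun i => (f i).2.1,
    strictMono_nat_of_lt_succ fun i => (hr i (i + 1) i.lt_succ_self).1, fun i j hij => ?_,
    fun i => (hf i).2.2.1, ?_⟩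
  · rcases hij.lt_or_gt with h | h
    exacts [(hr i j h).2.1, (hr j i h).2.1.symm]
  · refine HasAsympDensity.iUnion (δ := fun i => (f i).2.2) (fun i => (hf i).2.1.1)
      (fun i => (hf i).2.1.2)
      (summable_of_ratio_norm_eventually_le (r := 1 / 2) (by norm_num)
        (Eventually.of_forall fun i => ?_))
    rw [Real.norm_of_nonneg (hf _).1.le, Real.norm_of_nonneg (hf _).1.le]
    exact (hr i (i + 1) i.lt_succ_self).2.2

/-- A pointwise null and weakly null sequence of measures with supports of bounded size is not
bounded away from zero in norm. -/
theorem not_pointwise_null {θ : ℕ → StoneSpace plebanekAlgebra →₀ ℝ} {M : ℕ} {ε : ℝ} (hε : 0 < ε)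
    (hθ : ∀ n, ε ≤ l1Norm (θ n)) (hM : ∀ n, (θ n).support.card ≤ M)
    (h0 : ∀ a, Tendsto (fun n => mass (θ n) a) atTop (𝓝 0))
    (hx : ∀ x, Tendsto (fun n => θ n x) atTop (𝓝 0)) : False := by
  classical
  obtain ⟨n, F, hn, hF, hFn⟩ := exists_gliding_hump θ hx (ε := ε / 8) (by positivity)
  obtain ⟨k, a, hk, hadisj, ha, hdens⟩ := exists_disjoint_neighbourhoods hF
    fun i => (Finset.card_le_card (hFn i).1).trans (hM _)
  have hG (i : ℕ) : ∃ G ⊆ F (k i), (∑ x ∈ F (k i), |θ (n (k i)) x|) / 2 ≤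
      |∑ x ∈ G, θ (n (k i)) x| := exists_subset_half_le_abs_sum _ _
  choose G hGF hG using hG
  choose b hb hb' using fun i =>
    exists_forall_mem_forall_notMem (G i) (F (k i) \ G i) Finset.disjoint_sdiff
  -- The infinite union belongs to 𝒟 because it lies inside a set of density zero. Since the `a i`
  -- are disjoint, `B` meets `F (k i)` exactly in `G i`.
  set B : plebanekAlgebra := ofDensityZero (⋃ i, (a i : Set ℕ) ∩ b i)
    (hdens.mono_zero (Set.iUnion_mono fun i => Set.inter_subset_left))
  have hBa (i : ℕ) : B ⊓ a i = a i ⊓ b i := by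
    refine Subtype.ext (Set.Subset.antisymm ?_ ?_)
    · rintro x ⟨hxB, hxa⟩
      obtain ⟨j, hja, hjb⟩ := Set.mem_iUnion.1 hxB
      by_cases hij : i = j
      · exact hij ▸ ⟨hja, hjb⟩
      · exact ((hadisj hij).le_bot (⟨hxa, hja⟩ : x ∈ ((a i ⊓ a j : plebanekAlgebra) : Set ℕ))).elim
    · rintro x ⟨hxa, hxb⟩
      exact ⟨Set.mem_iUnion.2 ⟨i, hxa, hxb⟩, hxa⟩
  have hBu (i : ℕ) (u) (hu : u ∈ F (k i)) : B ∈ u.carrier ↔ u ∈ G i := by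
    have h1 : B ∈ u.carrier ↔ B ⊓ a i ∈ u.carrier := by
      rw [inf_mem_iff]
      exact ⟨fun h => ⟨h, ha i u hu⟩, And.left⟩
    rw [h1, hBa, inf_mem_iff]
    refine ⟨fun h => ?_, fun h => ⟨ha i u hu, hb i u h⟩⟩
    by_contra hGu
    exact hb' i u (Finset.mem_sdiff.2 ⟨hu, hGu⟩) h.2
  -- The hump carries at least 7ε/8, `G i` at least half of it, and the remainder spoils at most
  -- ε/8: what is left is 5ε/16 ≥ ε/4.
  have hlow (i : ℕ) : ε / 4 ≤ |mass (θ (n (k i))) B| := by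
    set c := θ (n (k i)) with hc
    obtain ⟨hsub, herr⟩ := hFn (k i)
    rw [← hc] at hsub herr
    have h1 : l1Norm c = ∑ x ∈ c.support \ F (k i), |c x| + ∑ x ∈ F (k i), |c x| := by
      rw [l1Norm_eq_sum subset_rfl, Finset.sum_sdiff hsub]
    have h2 : mass c B = (∑ x ∈ c.support \ F (k i), if B ∈ x.carrier then c x else 0) +
        ∑ x ∈ G i, c x := by
      rw [mass_eq_sum subset_rfl, ← Finset.sum_sdiff hsub]
      congr 1
      rw [← Finset.sum_filter]
      refine Finset.sum_congr (Finset.ext fun x => ?_) fun _ _ => rfl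
      rw [Finset.mem_filter]
      exact ⟨fun h => (hBu i x h.1).1 h.2, fun h => ⟨hGF i h, (hBu i x (hGF i h)).2 h⟩⟩
    have h3 : |∑ x ∈ c.support \ F (k i), if B ∈ x.carrier then c x else 0| ≤ ε / 8 := by
      refine (Finset.abs_sum_le_sum_abs _ _).trans ((Finset.sum_le_sum fun x _ => ?_).trans herr)
      split_ifs <;> simp
    have h4 := hG i
    rw [← hc] at h4
    have h5 := abs_sub_abs_le_abs_sub (∑ x ∈ G i, c x)
      (-∑ x ∈ c.support \ F (k i), if B ∈ x.carrier then c x else 0)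
    rw [abs_neg, sub_neg_eq_add, add_comm, ← h2] at h5
    linarith [hθ (n (k i))]
  have hlim := ((h0 B).comp (hn.comp hk).tendsto_atTop).abs
  rw [abs_zero] at hlim
  have := ge_of_tendsto' hlim hlow
  linarith

/-! ### Existence of a JN-sequence -/

open scoped Classical in
/-- Half the difference between the average of the first `n + 1` principal ultrafilters and the
ultrafilter of sets of density one. -/
def cesaroDifference (n : ℕ) : StoneSpace plebanekAlgebra →₀ ℝ :=
  Finsupp.onFinset (insert densityOne ((Finset.range (n + 1)).image principal))
    (fun x => if x = densityOne then -(1 / 2) else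
      if x ∈ (Finset.range (n + 1)).image principal then 1 / (2 * (n + 1)) else 0)
    (fun x hx => by
      by_contra h
      rw [Finset.mem_insert, not_or] at h
      exact hx (by rw [if_neg h.1, if_neg h.2]))

theorem cesaroDifference_densityOne (n : ℕ) : cesaroDifference n densityOne = -(1 / 2) := by
  simp [cesaroDifference]

theorem cesaroDifference_principal {n i : ℕ} (hi : i ∈ Finset.range (n + 1)) :
    cesaroDifference n (principal i) = 1 / (2 * (n + 1)) := by
  classical
  rw [cesaroDifference, Finsupp.onFinset_apply, if_neg (principal_ne_densityOne i),
    if_pos (Finset.mem_image_of_mem _ hi)]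

/-- Evaluates both the norm and the integrals. -/
theorem cesaroDifference_sum (n : ℕ) (g : StoneSpace plebanekAlgebra → ℝ → ℝ)
    (hg : ∀ x, g x 0 = 0) :
    (cesaroDifference n).sum g = g densityOne (-(1 / 2)) +
      ∑ i ∈ Finset.range (n + 1), g (principal i) (1 / (2 * (n + 1))) := by
  classical
  have hnot : densityOne ∉ (Finset.range (n + 1)).image principal := by
    rw [Finset.mem_image]
    rintro ⟨i, -, hi⟩
    exact principal_ne_densityOne i hi
  have hsupp : (cesaroDifference n).support ⊆
      insert densityOne ((Finset.range (n + 1)).image principal) :=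
    Finsupp.support_onFinset_subset
  rw [Finsupp.sum_of_support_subset _ hsupp _ fun x _ => hg x, Finset.sum_insert hnot,
    Finset.sum_image fun _ _ _ _ h => principal_injective h, cesaroDifference_densityOne]
  congr 1
  exact Finset.sum_congr rfl fun i hi => by rw [cesaroDifference_principal hi]

theorem l1Norm_cesaroDifference (n : ℕ) : l1Norm (cesaroDifference n) = 1 := by
  rw [l1Norm, cesaroDifference_sum n _ fun _ => abs_zero]
  have : (0 : ℝ) < n + 1 := by positivity
  rw [abs_neg, abs_of_pos one_half_pos, Finset.sum_const, Finset.card_range,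
    abs_of_pos (by positivity), nsmul_eq_mul]
  push_cast
  field_simp
  norm_num

/-- A neighbourhood of `densityOne` contains some [a] with a of density one, so the terms exceed any
η > 0 only on a set of density zero; compactness bounds f. -/
theorem tendsto_average_principal (f : C(StoneSpace plebanekAlgebra, ℝ)) :
    Tendsto (fun n : ℕ => (∑ i ∈ Finset.range n, (f (principal i) - f densityOne)) / n)
      atTop (𝓝 0) := by
  obtain ⟨C, hC⟩ := (isCompact_range f.continuous).isBounded.exists_norm_le
  have hC' (x) : |f x| ≤ C := hC _ (Set.mem_range_self x)
  refine tendsto_cesaro_zero_of_density (C := 2 * C) (fun i => ?_) fun η hη => ?_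
  · refine (abs_sub _ _).trans ?_
    linarith [hC' (principal i), hC' densityOne]
  · have hU : IsOpen {x | |f x - f densityOne| < η} :=
      isOpen_lt (by fun_prop) continuous_const
    obtain ⟨a, ha, haU⟩ := exists_basicClopen_subset hU (u := densityOne) (by simpa using hη)
    have h1 := HasAsympDensity.compl ha
    rw [sub_self] at h1
    refine h1.mono_zero fun i hi hia => ?_
    have h2 : |f (principal i) - f densityOne| < η := haU (show a ∈ (principal i).carrier from hia)
    exact absurd hi (not_le.2 h2)

theorem isJNSequence_cesaroDifference : IsJNSequence fun n => pointMeasure (cesaroDifference n) where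
  finitelySupported n := ⟨_, rfl⟩
  norm_eq_one n := by
    rw [variation_pointMeasure]
    have := l1Norm_cesaroDifference n
    rw [l1Norm_eq_sum subset_rfl] at this
    rw [this, ENNReal.ofReal_one]
  tendsto_integral f := by
    have h := (((tendsto_average_principal f).comp (tendsto_add_atTop_nat 1)).const_mul (1 / 2))
    rw [mul_zero] at h
    refine h.congr fun n => ?_
    rw [integral_pointMeasure]
    refine Eq.trans ?_ (cesaroDifference_sum n (fun x r => f x * r) fun x => mul_zero _).symm
    have : (n : ℝ) + 1 ≠ 0 := by positivity
    simp only [Function.comp_apply, Finset.sum_sub_distrib, Finset.sum_const, Finset.card_range,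
      nsmul_eq_mul, ← Finset.sum_mul]
    push_cast
    field_simp
    ring

end PlebanekAlgebra

/-! ### From integrals to masses, and the conclusion -/

namespace StoneSpace

open scoped VectorMeasure in
theorem integral_indicator_basicClopen {α : Type*} [BooleanAlgebra α] (c : StoneSpace α →₀ ℝ)
    (a : α) :
    ∫ᵛ x, (basicClopen a).indicator (fun _ => (1 : ℝ)) x ∂•(pointMeasure c) = mass c a := by
  classical
  rw [integral_pointMeasure, mass_eq_sum subset_rfl]
  refine Finset.sum_congr rfl fun x _ => ?_
  simp [Set.indicator_apply, basicClopen]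

/-- The indicator of a clopen set is a continuous test function. -/
theorem tendsto_mass_of_isJNSequence {α : Type*} [BooleanAlgebra α] {c : ℕ → StoneSpace α →₀ ℝ}
    (h : IsJNSequence fun n => pointMeasure (c n)) (a : α) :
    Tendsto (fun n => mass (c n) a) atTop (𝓝 0) := by
  have hcont : Continuous ((basicClopen a).indicator fun _ => (1 : ℝ)) :=
    (isClopen_basicClopen a).continuous_indicator continuous_const
  refine (h.tendsto_integral ⟨_, hcont⟩).congr fun n => ?_
  exact integral_indicator_basicClopen (c n) a

end StoneSpace

end

open StoneSpace PlebanekAlgebra in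
theorem proposition6p3 :
    (∃ μ : ℕ → SignedMeasure (StoneSpace plebanekAlgebra), IsJNSequence μ) ∧
    (∀ μ : ℕ → SignedMeasure (StoneSpace plebanekAlgebra), IsJNSequence μ →
      Tendsto (fun n => (finSupp (μ n)).ncard) atTop atTop) := by
  refine ⟨⟨_, isJNSequence_cesaroDifference⟩, fun μ hμ => ?_⟩
  choose c hc using hμ.finitelySupported
  obtain rfl : μ = fun n => pointMeasure (c n) := funext hc
  simp only [finSupp_pointMeasure, Set.ncard_coe_finset]
  rw [tendsto_atTop]
  intro m
  by_contra hm
  -- If the support sizes do not diverge, they are below some m along a subsequence.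
  obtain ⟨φ, hφ, hφm⟩ := extraction_of_frequently_atTop (not_eventually.1 hm)
  have hnorm (n : ℕ) : l1Norm (c n) = 1 := by
    have h := hμ.norm_eq_one n
    rw [variation_pointMeasure, ENNReal.ofReal_eq_one] at h
    rw [l1Norm_eq_sum subset_rfl, h]
  obtain ⟨θ, hθ, hcard, hmass, hnull⟩ := exists_pointwise_null (fun n => c (φ n)) m
    (fun n => hnorm _) (fun n => (not_le.1 (hφm n)).le)
    fun a => (tendsto_mass_of_isJNSequence hμ a).comp hφ.tendsto_atTop
  exact not_pointwise_null (by norm_num) hθ hcard hmass hnull
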